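/- Let $G=(V,E)$ be a finite directed acyclic multigraph with source $s$ and sink $t\neq s$, $t$ reachable from $s$, with capacities $c_e\ge 0$ and linear weights $w_e\in\mathbb R$ of arbitrary sign satisfying $w_{\min}\le |w_e|\le w_{\max}$ for every $e$, where $w_{\min}>0$. Let $\varepsilon=2^{-k}$ with $k\in\{0,1,2,\dots\}$, let $w_{\max}/w_{\min}=2^{T}$ with $T\in\{0,1,2,\dots\}$, and assume that every $w_e$ is an integer multiple of $\varepsilon w_{\min}$. A feasible flow is an $x\in\mathbb R^E$ with $0\le x_e\le c_e$, conserved at every vertex other than $s,t$, and with nonnegative net outflow at $s$; it is optimal if it maximizes $\sum_e w_ex_e$ over all feasible flows. For $u\in V$ let $l_u$ be the number of edges of a longest directed path from $s$ to $u$ ($0$ if there is none), let $D=l_t$, and let $\delta_i=\varepsilon w_{\max}/2^i$. For potentials $p\in\mathbb R^V$ and an edge $e=uv$ let $w_e^p=w_e+p_u-p_v$. The *eligible graph* of $(x,p)$ at scale $i$ has a forward arc $u\to v$ of capacity $c_e-x_e$ for every $e=uv$ with $x_e<c_e$ and $w^p_e\ge\delta_i$, and a backward arc $v\to u$ of capacity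 $x_e$ for every $e=uv$ with $x_e>0$ and $w^p_e\le 0$. A *blocking flow* is a feasible flow from $s$ to $t$ in the eligible graph that saturates at least one arc of every $s$–$t$ path of it. ScalingFlow starts with $x=0$, $p_u=w_{\max}l_u$ and processes the scales $i=i_0,i_0+1,\dots,T$, where $i_0\in\{0,1\}$, $i_0\le T$. At scale $i$ it repeats the following until $p_t=Dw_{\max}/2^{i+1}$ if $i<T$, or until $p_t=0$ if $i=T$: augment $x$ by a blocking flow of the eligible graph; recompute the eligible graph; replace $p_u$ by $p_u-\delta_i$ for every $u$ not reachable from $s$ in it. At the end of each scale $i<T$ it replaces $p_u$ by $p_u+\delta_i l_u$ for all $u$. After scale $T$ it returns $x$. **Lemma.** Let $x$ be a flow returned by ScalingFlow (for either choice of $i_0$ and any choice of the blocking flows), and let $x^*$ be an optimal flow. Then $$\sum_e w_ex_e\ \ge\ (1-8\varepsilon)\sum_{e:\,w_e>0}w_ex^*_e\ +\ (1+8\varepsilon)\sum_{e:\,w_e<0}w_ex^*_e .$$ -/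

import Mathlib

namespace ScalingFlow

/-- The directed multigraph with arcs `a : A` from `tail a` to `head a`, restricted to the arcs
with property `P`, has a directed path from `u` to `v`. -/
def Reaches {V A : Type*} (tail head : A → V) (P : A → Prop) (u v : V) : Prop :=
  Relation.ReflTransGen (fun y z => ∃ a, P a ∧ tail a = y ∧ head a = z) u v

open Classical in
/-- Amount of flow leaving `u` minus amount of flow entering `u`. -/
noncomputable def netOut {V A : Type*} [Fintype A] (tail head : A → V) (f : A → ℝ) (u : V) : ℝ :=
  (∑ a, if tail a = u then f a else 0) - ∑ a, if head a = u then f a else 0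

/-- `f` is a feasible flow from `s` to `t`. The last condition says that the value of the flow is
nonnegative: the flow can be closed up by a nonnegative amount on an added uncapacitated
arc from `t` to `s`. -/
structure IsFlow {V A : Type*} [Fintype A] (tail head : A → V) (cap : A → ℝ) (s t : V)
    (f : A → ℝ) : Prop where
  nonneg : ∀ a, 0 ≤ f a
  le_cap : ∀ a, f a ≤ cap a
  conserved : ∀ u, u ≠ s → u ≠ t → netOut tail head f u = 0
  value_nonneg : 0 ≤ netOut tail head f s

/-- A blocking flow: a flow such that every path from `s` to `t` contains a saturated arc. (Arcs of
capacity zero are always saturated, so they play no role.) -/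
def IsBlockingFlow {V A : Type*} [Fintype A] (tail head : A → V) (cap : A → ℝ) (s t : V)
    (f : A → ℝ) : Prop :=
  IsFlow tail head cap s t f ∧ ¬ Reaches tail head (fun a => f a < cap a) s t

/-- A directed acyclic network (parallel edges allowed) with source `s`, sink `t`, capacities `cap`
and linear weights `w` of any sign. -/
structure Network (V E : Type*) where
  tail : E → V
  head : E → V
  s : V
  t : V
  cap : E → ℝ
  w : E → ℝ
  cap_nonneg : ∀ e, 0 ≤ cap e
  acyclic : ∀ u, ¬ Relation.TransGen (fun y z => ∃ e, tail e = y ∧ head e = z) u u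
  s_ne_t : s ≠ t
  s_reaches_t : Reaches tail head (fun _ => True) s t

namespace Network

variable {V E : Type*}

/-- There is a directed path with `n` edges from `s` to the given vertex. -/
inductive HasPath (N : Network V E) : V → ℕ → Prop
  | nil : HasPath N N.s 0
  | snoc (e : E) (n : ℕ) : HasPath N (N.tail e) n → HasPath N (N.head e) (n + 1)

/-- The level of `u`: the length of a longest path from `s` to `u` (and `0` if there is none). -/
noncomputable def level (N : Network V E) (u : V) : ℕ := sSup {n | N.HasPath u n}

/-- The depth of the network: the length of a longest path from `s` to `t`. -/
noncomputable def depth (N : Network V E) : ℕ := N.level N.t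

/-- `x` is a feasible flow of the network. -/
def Feasible [Fintype E] (N : Network V E) (x : E → ℝ) : Prop :=
  IsFlow N.tail N.head N.cap N.s N.t x

/-- `x` is a feasible flow of maximum total weight. -/
def Optimal [Fintype E] (N : Network V E) (x : E → ℝ) : Prop :=
  N.Feasible x ∧ ∀ y, N.Feasible y → ∑ e, N.w e * y e ≤ ∑ e, N.w e * x e

/-- Reduced weight of the edge `e = uv` under the potential `p`. -/
def reducedWeight (N : Network V E) (p : V → ℝ) (e : E) : ℝ :=
  N.w e + p (N.tail e) - p (N.head e)

/-- Tail of a residual arc: `inl e` is `e` used forward, `inr e` is `e` used backward. -/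
def arcTail (N : Network V E) : E ⊕ E → V := Sum.elim N.tail N.head

/-- Head of a residual arc. -/
def arcHead (N : Network V E) : E ⊕ E → V := Sum.elim N.head N.tail

/-- Flow and vertex potentials. -/
@[ext]
structure State (V E : Type*) where
  x : E → ℝ
  p : V → ℝ

open Classical in
/-- Capacities of the eligible graph for step size `δ`: a forward arc with reduced weight at least
`δ` has its residual capacity, a backward arc with reduced weight at most `0` can carry back the
flow on the edge, and all other residual arcs are ineligible (capacity `0`). The eligible
graph consists of the arcs of positive capacity. -/
noncomputable def eligibleCap (N : Network V E) (δ : ℝ) (σ : State V E) : E ⊕ E → ℝ :=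
  Sum.elim
    (fun e => if δ ≤ N.reducedWeight σ.p e then N.cap e - σ.x e else 0)
    (fun e => if N.reducedWeight σ.p e ≤ 0 then σ.x e else 0)

/-- `u` is reachable from `s` in the eligible graph. -/
def EligibleVertex (N : Network V E) (δ : ℝ) (σ : State V E) (u : V) : Prop :=
  Reaches N.arcTail N.arcHead (fun a => 0 < N.eligibleCap δ σ a) N.s u

/-- Augmentation of the current flow by a flow `f` in the eligible graph. -/
def augment (σ : State V E) (f : E ⊕ E → ℝ) : State V E where
  x := fun e => σ.x e + f (Sum.inl e) - f (Sum.inr e)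
  p := σ.p

open Classical in
/-- Dual adjustment: lower by `δ` the potentials of all vertices that are not reachable from `s` in
the eligible graph (of the given state). -/
noncomputable def dualAdjust (N : Network V E) (δ : ℝ) (σ : State V E) : State V E where
  x := σ.x
  p := fun u => if N.EligibleVertex δ σ u then σ.p u else σ.p u - δ

/-- One iteration with step size `δ`: augment by some blocking flow of the eligible graph, recompute
the eligible graph, adjust the potentials. -/
def Iteration [Fintype E] (N : Network V E) (δ : ℝ) (σ σ' : State V E) : Prop :=
  ∃ f, IsBlockingFlow N.arcTail N.arcHead (N.eligibleCap δ σ) N.s N.t f ∧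
    σ' = N.dualAdjust δ (augment σ f)

/-- Repeat iterations with step size `δ` until the potential of `t` equals `target`. -/
inductive Loop [Fintype E] (N : Network V E) (δ target : ℝ) : State V E → State V E → Prop
  | done (σ : State V E) : σ.p N.t = target → Loop N δ target σ σ
  | step (σ σ' σ'' : State V E) : σ.p N.t ≠ target → N.Iteration δ σ σ' →
      Loop N δ target σ' σ'' → Loop N δ target σ σ''

/-- Step size `δᵢ = ε w_max / 2ⁱ`. -/
noncomputable def stepSize (ε wmax : ℝ) (i : ℕ) : ℝ := ε * wmax / 2 ^ i

/-- Value of the potential of `t` at which scale `i` ends (`T` is the last scale). -/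
noncomputable def scaleTarget (N : Network V E) (wmax : ℝ) (T i : ℕ) : ℝ :=
  if i < T then N.depth * wmax / 2 ^ (i + 1) else 0

/-- Dual rescaling between two scales. -/
noncomputable def rescale (N : Network V E) (δ : ℝ) (σ : State V E) : State V E where
  x := σ.x
  p := fun u => σ.p u + δ * N.level u

/-- Run the scales `i, i + 1, …, T`. -/
inductive Scales [Fintype E] (N : Network V E) (ε wmax : ℝ) (T : ℕ) :
    ℕ → State V E → State V E → Prop
  | last (σ σ' : State V E) :
      N.Loop (stepSize ε wmax T) (N.scaleTarget wmax T T) σ σ' → Scales N ε wmax T T σ σ'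
  | next (i : ℕ) (σ σ' σ'' : State V E) : i < T →
      N.Loop (stepSize ε wmax i) (N.scaleTarget wmax T i) σ σ' →
      Scales N ε wmax T (i + 1) (N.rescale (stepSize ε wmax i) σ') σ'' →
      Scales N ε wmax T i σ σ''

/-- Initial state: zero flow, potentials `w_max * level`. -/
noncomputable def initial (N : Network V E) (wmax : ℝ) : State V E where
  x := fun _ => 0
  p := fun u => wmax * N.level u

/-- `x` is a flow that ScalingFlow with scales `i₀, i₀ + 1, …, T` can return; it depends on the
blocking flows chosen during the run. -/
def Returns [Fintype E] (N : Network V E) (ε wmax : ℝ) (i₀ T : ℕ) (x : E → ℝ) : Prop :=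
  ∃ σ, N.Scales ε wmax T i₀ (N.initial wmax) σ ∧ σ.x = x

end Network

end ScalingFlow

/-! The proof is approximate complementary slackness with an amortized error. The final potentials
vanish at `s` and `t`, so reduced weights give every feasible flow its true weight. On edges
accessible from `s`, unsaturated ones have reduced weight below twice the last step, and `slack 0`
measures the flow on edges of negative reduced weight. Hence (`Valid.weight_le`) an optimal flow
beats the result by at most `2 * ε * wmin * ∑ xstar e` plus `slack 0`.

The slack is bounded only in total, by charging it to the weight of the flow. At step size `δ` the
invariant is `slack δ + 2 * δ * climb ≤ 6 * ε * weight`. Augmenting by value `v` gains weight at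
least `target * v` and raises the left side by at most `3 * δ * depth * v`, which is `6 * ε * target
* v`. Dual adjustments cost nothing, because `slack` already charges `δ` per level. Rescaling costs
at most `δ * climb`, paid from the reserve `2 * δ * climb`, of which the next step size needs only
half. In the last scale `δ` is the grid width, so no positive reduced weight becomes negative and
`slack 0` can be tracked directly. -/

namespace ScalingFlow

/-! ### Flows and potentials -/

section Flow

variable {V A : Type*} [Fintype V] [Fintype A] {tail head : A → V}

/-- Summation by parts for potentials and flows. -/
theorem sum_mul_netOut (tail head : A → V) (f : A → ℝ) (q : V → ℝ) :
    ∑ u, q u * netOut tail head f u = ∑ a, f a * (q (tail a) - q (head a)) := by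
  classical
  simp only [netOut, mul_sub, Finset.sum_sub_distrib, Finset.mul_sum]
  rw [Finset.sum_comm, Finset.sum_comm (f := fun u a => q u * if head a = u then f a else 0)]
  simp [mul_comm]

theorem IsFlow.sum_potential {cap : A → ℝ} {s t : V} {f : A → ℝ}
    (h : IsFlow tail head cap s t f) (hst : s ≠ t) (q : V → ℝ) :
    ∑ a, f a * (q (tail a) - q (head a)) = (q s - q t) * netOut tail head f s := by
  classical
  have key (r : V → ℝ) : ∑ a, f a * (r (tail a) - r (head a))
      = r s * netOut tail head f s + r t * netOut tail head f t := by
    rw [← sum_mul_netOut, ← Finset.sum_pair (f := fun u => r u * netOut tail head f u) hst]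
    refine (Finset.sum_subset (Finset.subset_univ _) fun u _ hu => ?_).symm
    simp only [Finset.mem_insert, Finset.mem_singleton, not_or] at hu
    rw [h.conserved u hu.1 hu.2, mul_zero]
  -- The constant potential shows that what leaves `s` arrives at `t`.
  have h1 := key fun _ => 1
  simp only [sub_self, mul_zero, Finset.sum_const_zero, one_mul] at h1
  rw [key, show netOut tail head f t = -netOut tail head f s by linarith]
  ring

end Flow

namespace Network

variable {V E : Type*} (N : Network V E)

/-! ### Accessibility and levels -/

/-- There is a nontrivial directed path from `u` to `v`. -/
def Precedes (u v : V) : Prop :=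
  Relation.TransGen (fun y z => ∃ e, N.tail e = y ∧ N.head e = z) u v

/-- There is a directed path from `s` to `u`. -/
def Accessible (u : V) : Prop := ∃ n, N.HasPath u n

theorem accessible_head {e : E} (h : N.Accessible (N.tail e)) : N.Accessible (N.head e) :=
  h.elim fun n hn => ⟨n + 1, .snoc e n hn⟩

theorem accessible_t : N.Accessible N.t := by
  have h (v : V) (hv : Reaches N.tail N.head (fun _ => True) N.s v) : N.Accessible v := by
    induction hv with
    | refl => exact ⟨0, .nil⟩
    | tail _ hbc ih =>
      obtain ⟨e, _, rfl, rfl⟩ := hbc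
      exact N.accessible_head ih
  exact h _ N.s_reaches_t

theorem HasPath.eq_or_precedes {N : Network V E} {u : V} {n : ℕ} (h : N.HasPath u n) :
    (u = N.s ∧ n = 0) ∨ N.Precedes N.s u := by
  induction h with
  | nil => exact .inl ⟨rfl, rfl⟩
  | snoc e n _ ih =>
    right
    rcases ih with ⟨h, _⟩ | h
    · exact .single ⟨e, h, rfl⟩
    · exact .tail h ⟨e, rfl, rfl⟩

theorem level_s : N.level N.s = 0 := by
  have h : {n | N.HasPath N.s n} = {0} := by
    ext n
    constructor
    · intro hn
      rcases HasPath.eq_or_precedes hn with h | h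
      · exact h.2
      · exact (N.acyclic _ h).elim
    · rintro rfl
      exact .nil
  rw [level, h, csSup_singleton]

theorem level_of_not_accessible {u : V} (h : ¬ N.Accessible u) : N.level u = 0 := by
  have h' : {n | N.HasPath u n} = ∅ := Set.eq_empty_of_forall_notMem fun n hn => h ⟨n, hn⟩
  rw [level, h', csSup_empty]
  rfl

/-- Increase of the level along an edge. -/
noncomputable def levelGap (e : E) : ℝ := N.level (N.head e) - N.level (N.tail e)

/-- Number of predecessors of a vertex. -/
noncomputable def predCount (u : V) : ℕ := {z | N.Precedes z u}.ncard

variable {N}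

/-! ### Eligibility and dual adjustment -/

theorem eligibleVertex_s (δ : ℝ) (σ : State V E) : N.EligibleVertex δ σ N.s := .refl

theorem EligibleVertex.head {δ : ℝ} {σ : State V E} {e : E} (hx : σ.x e < N.cap e)
    (hw : δ ≤ N.reducedWeight σ.p e) (h : N.EligibleVertex δ σ (N.tail e)) :
    N.EligibleVertex δ σ (N.head e) :=
  Relation.ReflTransGen.tail h ⟨Sum.inl e, by simp [eligibleCap, hw, hx], rfl, rfl⟩

theorem EligibleVertex.tail {δ : ℝ} {σ : State V E} {e : E} (hx : 0 < σ.x e)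
    (hw : N.reducedWeight σ.p e ≤ 0) (h : N.EligibleVertex δ σ (N.head e)) :
    N.EligibleVertex δ σ (N.tail e) :=
  Relation.ReflTransGen.tail h ⟨Sum.inr e, by simp [eligibleCap, hw, hx], rfl, rfl⟩

theorem dualAdjust_p_eq (δ : ℝ) (σ : State V E) (u : V) :
    (N.dualAdjust δ σ).p u = σ.p u ∨ (N.dualAdjust δ σ).p u = σ.p u - δ := by
  simp only [dualAdjust]
  split_ifs <;> simp

theorem reducedWeight_rescale (δ : ℝ) (σ : State V E) (e : E) :
    N.reducedWeight (N.rescale δ σ).p e = N.reducedWeight σ.p e - δ * N.levelGap e := by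
  simp only [reducedWeight, rescale, levelGap]
  ring

/-- The change of the flow on an edge caused by a flow in the residual graph. -/
def netFlow (f : E ⊕ E → ℝ) (e : E) : ℝ := f (Sum.inl e) - f (Sum.inr e)

/-- A dual adjustment lowers the reduced weight of a flow-carrying edge only if it is positive, and
then by at most `δ`. -/
theorem reducedWeight_dualAdjust_ge {δ : ℝ} (hδ : 0 < δ) {σ : State V E} {e : E}
    (hx : 0 < σ.x e) :
    N.reducedWeight σ.p e ≤ N.reducedWeight (N.dualAdjust δ σ).p e ∨
      (0 < N.reducedWeight σ.p e ∧
        N.reducedWeight σ.p e - δ ≤ N.reducedWeight (N.dualAdjust δ σ).p e) := by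
  rcases le_or_gt (N.reducedWeight σ.p e) 0 with hw | hw
  · left
    -- The backward arc is eligible, so the tail is reachable whenever the head is; the tail is
    -- never lowered alone.
    have h := EligibleVertex.tail (δ := δ) hx hw
    by_cases h1 : N.EligibleVertex δ σ (N.tail e) <;>
      by_cases h2 : N.EligibleVertex δ σ (N.head e) <;>
      simp only [reducedWeight, dualAdjust, h1, h2, if_true, if_false] <;>
      first | linarith | exact absurd (h h2) h1
  · refine .inr ⟨hw, ?_⟩
    simp only [reducedWeight, dualAdjust]
    split_ifs <;> linarith

/-- The reduced weight rises only if the tail is reachable and the head is not. The forward arc is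
then ineligible, so the old value was below `δ`. -/
theorem reducedWeight_dualAdjust_lt {δ : ℝ} (hδ : 0 < δ) {σ : State V E} {e : E}
    (hx : σ.x e < N.cap e) (hw : N.reducedWeight σ.p e < 2 * δ) :
    N.reducedWeight (N.dualAdjust δ σ).p e < 2 * δ := by
  have h := EligibleVertex.head (δ := δ) (e := e) hx
  unfold reducedWeight at hw h ⊢
  by_cases h1 : N.EligibleVertex δ σ (N.tail e) <;>
    by_cases h2 : N.EligibleVertex δ σ (N.head e) <;>
    simp only [dualAdjust, h1, h2, if_true, if_false]
  · exact hw
  · have := lt_of_not_ge fun h3 => h2 (h h3 h1)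
    linarith
  · linarith
  · linarith

/-! ### Augmentation and loops -/

section Augment

variable [Fintype E]

theorem netOut_augment (σ : State V E) (f : E ⊕ E → ℝ) (u : V) :
    netOut N.tail N.head (augment σ f).x u
      = netOut N.tail N.head σ.x u + netOut N.arcTail N.arcHead f u := by
  classical
  have h (g : E → V) : ∑ e, (if g e = u then σ.x e + f (Sum.inl e) - f (Sum.inr e) else 0)
      = ∑ e, (if g e = u then σ.x e else 0) + ∑ e, (if g e = u then f (Sum.inl e) else 0)
        - ∑ e, (if g e = u then f (Sum.inr e) else 0) := by
    rw [← Finset.sum_add_distrib, ← Finset.sum_sub_distrib]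
    exact Finset.sum_congr rfl fun e _ => by split_ifs <;> simp
  have hring (a b c a' b' c' : ℝ) :
      (a + b - c) - (a' + b' - c') = (a - a') + ((b + c') - (b' + c)) := by ring
  refine (congrArg₂ (· - ·) (h N.tail) (h N.head)).trans ?_
  simp only [netOut, Fintype.sum_sum_type]
  exact hring _ _ _ _ _ _

/-- What an augmenting flow can do to an edge. -/
theorem eligible_flow_bounds {δ : ℝ} {σ : State V E} {f : E ⊕ E → ℝ} (hσ : N.Feasible σ.x)
    (hf : IsFlow N.arcTail N.arcHead (N.eligibleCap δ σ) N.s N.t f) (e : E) :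
    (0 ≤ f (Sum.inl e) ∧ f (Sum.inl e) ≤ N.cap e - σ.x e ∧
      (N.reducedWeight σ.p e < δ → f (Sum.inl e) = 0)) ∧
    (0 ≤ f (Sum.inr e) ∧ f (Sum.inr e) ≤ σ.x e ∧
      (0 < N.reducedWeight σ.p e → f (Sum.inr e) = 0)) := by
  have h1 := hf.nonneg (Sum.inl e)
  have h2 := hf.nonneg (Sum.inr e)
  have h3 := hf.le_cap (Sum.inl e)
  have h4 := hf.le_cap (Sum.inr e)
  have h5 := hσ.nonneg e
  have h6 := hσ.le_cap e
  simp only [eligibleCap, Sum.elim_inl, Sum.elim_inr] at h3 h4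
  refine ⟨⟨h1, ?_, fun h => ?_⟩, h2, ?_, fun h => ?_⟩
  · split_ifs at h3 <;> linarith
  · rw [if_neg h.not_ge] at h3; linarith
  · split_ifs at h4 <;> linarith
  · rw [if_neg h.not_ge] at h4; linarith

theorem Iteration.p_t_le {δ : ℝ} (hδ : 0 < δ) {σ σ' : State V E} (h : N.Iteration δ σ σ') :
    σ'.p N.t ≤ σ.p N.t := by
  obtain ⟨f, _, rfl⟩ := h
  have hp : (augment σ f).p = σ.p := rfl
  rcases dualAdjust_p_eq δ (augment σ f) N.t with h | h <;> rw [h, hp]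
  linarith

/-- The potential of `t` never rises and the loop ends at `target`. -/
theorem Loop.target_le {δ target : ℝ} (hδ : 0 < δ) {σ σ' : State V E}
    (h : N.Loop δ target σ σ') : target ≤ σ.p N.t := by
  induction h with
  | done σ h => exact h.ge
  | step σ σ' σ'' _ h _ ih => exact ih.trans (h.p_t_le hδ)

theorem Loop.p_t_eq {δ target : ℝ} {σ σ' : State V E}
    (h : N.Loop δ target σ σ') : σ'.p N.t = target := by
  induction h with
  | done σ h => exact h
  | step σ σ' σ'' _ _ _ ih => exact ih

theorem Loop.invariant {δ target : ℝ} (hδ : 0 < δ) {I : State V E → Prop}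
    (hI : ∀ σ σ', target ≤ σ.p N.t → N.Iteration δ σ σ' → I σ → I σ') {σ σ' : State V E}
    (h : N.Loop δ target σ σ') (h0 : I σ) : I σ' := by
  induction h with
  | done σ _ => exact h0
  | step σ σ' σ'' hne h hl ih =>
    exact ih (hI σ σ' ((Loop.step σ σ' σ'' hne h hl).target_le hδ) h h0)

theorem sum_augment (σ : State V E) (f : E ⊕ E → ℝ) (c : E → ℝ) :
    ∑ e, (augment σ f).x e * c e = ∑ e, σ.x e * c e + ∑ e, netFlow f e * c e := by
  rw [← Finset.sum_add_distrib]
  exact Finset.sum_congr rfl fun e _ => by simp only [augment, netFlow]; ring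

/-- Total weight of a flow. -/
noncomputable def weight (N : Network V E) (x : E → ℝ) : ℝ := ∑ e, N.w e * x e

theorem weight_augment (σ : State V E) (f : E ⊕ E → ℝ) :
    N.weight (augment σ f).x = N.weight σ.x + ∑ e, N.w e * netFlow f e := by
  have := sum_augment σ f N.w
  simpa only [weight, mul_comm] using this

theorem feasible_augment {δ : ℝ} {σ : State V E} {f : E ⊕ E → ℝ} (hσ : N.Feasible σ.x)
    (hf : IsFlow N.arcTail N.arcHead (N.eligibleCap δ σ) N.s N.t f) :
    N.Feasible (augment σ f).x where
  nonneg e := by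
    have := eligible_flow_bounds hσ hf e
    simp only [augment]; linarith
  le_cap e := by
    have := eligible_flow_bounds hσ hf e
    simp only [augment]; linarith
  conserved u hs ht := by
    rw [netOut_augment, IsFlow.conserved hσ u hs ht, hf.conserved u hs ht, add_zero]
  value_nonneg := by
    rw [netOut_augment]
    exact add_nonneg hσ.value_nonneg hf.value_nonneg

end Augment

/-! ### Consequences of acyclicity -/

section Finite

variable (N)

variable [Fintype V]

/-- By acyclicity the tail precedes the head but not itself. This ranking bounds path lengths, so
the supremum in `level` is attained. -/
theorem predCount_lt (e : E) : N.predCount (N.tail e) < N.predCount (N.head e) := by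
  refine Set.ncard_lt_ncard ⟨fun z hz => .tail hz ⟨e, rfl, rfl⟩, fun h => ?_⟩ (Set.toFinite _)
  exact N.acyclic (N.tail e) (h (Relation.TransGen.single ⟨e, rfl, rfl⟩))

theorem predCount_le (u : V) : N.predCount u ≤ Fintype.card V := by
  rw [← Nat.card_eq_fintype_card, ← Set.ncard_univ]
  exact Set.ncard_le_ncard (Set.subset_univ _) (Set.toFinite _)

theorem HasPath.le_predCount {N : Network V E} {u : V} {n : ℕ} (h : N.HasPath u n) :
    n ≤ N.predCount u := by
  induction h with
  | nil => exact Nat.zero_le _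
  | snoc e n _ ih => have := N.predCount_lt e; omega

theorem bddAbove_hasPath (u : V) : BddAbove {n | N.HasPath u n} :=
  ⟨_, fun _ hn => HasPath.le_predCount hn⟩

theorem one_le_levelGap {e : E} (h : N.Accessible (N.tail e)) : 1 ≤ N.levelGap e := by
  have h1 : N.HasPath (N.tail e) (N.level (N.tail e)) := Nat.sSup_mem h (N.bddAbove_hasPath _)
  have h2 : N.level (N.tail e) + 1 ≤ N.level (N.head e) :=
    le_csSup (N.bddAbove_hasPath _) (HasPath.snoc e _ h1)
  have h3 : ((N.level (N.tail e) : ℝ) + 1) ≤ N.level (N.head e) := by exact_mod_cast h2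
  unfold levelGap
  linarith

/-- The default level `0` at an inaccessible tail matters here. -/
theorem levelGap_nonneg (e : E) : 0 ≤ N.levelGap e := by
  by_cases h : N.Accessible (N.tail e)
  · linarith [N.one_le_levelGap h]
  · simp [levelGap, N.level_of_not_accessible h]

variable [Fintype E] {N}

/-- A flow vanishes on edges that cannot be reached from the source. -/
theorem Feasible.eq_zero {x : E → ℝ} (hx : N.Feasible x) {e : E}
    (he : ¬ N.Accessible (N.tail e)) : x e = 0 := by
  classical
  -- This potential drops strictly along edges with inaccessible tail (the `+ 1` covers accessible
  -- heads) and is constant on all others. As it vanishes at `s` and `t`, the drops collected by the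
  -- flow sum to zero.
  set q : V → ℝ := fun u => if N.Accessible u then 0 else Fintype.card V + 1 - N.predCount u
    with hq
  have hpos (a : E) (ha : ¬ N.Accessible (N.tail a)) : 0 < q (N.tail a) - q (N.head a) := by
    have h1 : (N.predCount (N.tail a) : ℝ) < N.predCount (N.head a) := by
      exact_mod_cast N.predCount_lt a
    have h2 : (N.predCount (N.tail a) : ℝ) ≤ Fintype.card V := by
      exact_mod_cast N.predCount_le _
    by_cases hb : N.Accessible (N.head a) <;> simp only [hq, ha, hb, if_true, if_false] <;>
      linarith
  have hnn (a : E) : 0 ≤ x a * (q (N.tail a) - q (N.head a)) := by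
    by_cases ha : N.Accessible (N.tail a)
    · simp [hq, ha, N.accessible_head ha]
    · exact mul_nonneg (hx.nonneg a) (hpos a ha).le
  have hs : N.Accessible N.s := ⟨0, .nil⟩
  have hsum := IsFlow.sum_potential hx N.s_ne_t q
  have hz : (q N.s - q N.t) * netOut N.tail N.head x N.s = 0 := by
    simp [hq, hs, N.accessible_t]
  rw [hz, Finset.sum_eq_zero_iff_of_nonneg fun a _ => hnn a] at hsum
  exact (mul_eq_zero.1 (hsum e (Finset.mem_univ e))).resolve_right (hpos e he).ne'

theorem Feasible.sum_reducedWeight {x : E → ℝ} (hx : N.Feasible x) {p : V → ℝ}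
    (hs : p N.s = 0) :
    ∑ e, N.reducedWeight p e * x e
      = ∑ e, N.w e * x e - p N.t * netOut N.tail N.head x N.s := by
  have h := IsFlow.sum_potential hx N.s_ne_t p
  rw [hs] at h
  have h2 : ∑ e, N.reducedWeight p e * x e
      = ∑ e, N.w e * x e + ∑ e, x e * (p (N.tail e) - p (N.head e)) := by
    rw [← Finset.sum_add_distrib]
    exact Finset.sum_congr rfl fun e _ => by unfold reducedWeight; ring
  rw [h2, h]
  ring

/-- Potential differences collected by an augmenting flow. -/
theorem sum_netFlow_potential {δ : ℝ} {σ : State V E} {f : E ⊕ E → ℝ}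
    (hf : IsFlow N.arcTail N.arcHead (N.eligibleCap δ σ) N.s N.t f) (q : V → ℝ) :
    ∑ e, netFlow f e * (q (N.tail e) - q (N.head e))
      = (q N.s - q N.t) * netOut N.arcTail N.arcHead f N.s := by
  rw [← hf.sum_potential N.s_ne_t q, Fintype.sum_sum_type, ← Finset.sum_add_distrib]
  refine Finset.sum_congr rfl fun e _ => ?_
  simp only [netFlow, arcTail, arcHead, Sum.elim_inl, Sum.elim_inr]
  ring

theorem sum_netFlow_levelGap {δ : ℝ} {σ : State V E} {f : E ⊕ E → ℝ}
    (hf : IsFlow N.arcTail N.arcHead (N.eligibleCap δ σ) N.s N.t f) :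
    ∑ e, netFlow f e * N.levelGap e = N.depth * netOut N.arcTail N.arcHead f N.s := by
  have h := sum_netFlow_potential hf fun u => -(N.level u : ℝ)
  simp only [N.level_s, Nat.cast_zero, neg_zero, zero_sub, neg_neg] at h
  rw [depth, ← h]
  exact Finset.sum_congr rfl fun e _ => by unfold levelGap; ring

/-- Every unit of augmentation gains at least the potential of the sink. -/
theorem mul_value_le_sum_netFlow {δ : ℝ} (hδ : 0 < δ) {σ : State V E} {f : E ⊕ E → ℝ}
    (hσ : N.Feasible σ.x) (hs : σ.p N.s = 0)
    (hf : IsFlow N.arcTail N.arcHead (N.eligibleCap δ σ) N.s N.t f) :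
    σ.p N.t * netOut N.arcTail N.arcHead f N.s ≤ ∑ e, N.w e * netFlow f e := by
  have h := sum_netFlow_potential hf σ.p
  rw [hs] at h
  have h2 : ∑ e, N.w e * netFlow f e = ∑ e, N.reducedWeight σ.p e * netFlow f e
      - ∑ e, netFlow f e * (σ.p (N.tail e) - σ.p (N.head e)) := by
    rw [← Finset.sum_sub_distrib]
    exact Finset.sum_congr rfl fun e _ => by unfold reducedWeight; ring
  -- Forward flow uses reduced weights at least `δ`, backward flow only nonpositive ones.
  have h3 : 0 ≤ ∑ e, N.reducedWeight σ.p e * netFlow f e := by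
    refine Finset.sum_nonneg fun e _ => ?_
    obtain ⟨⟨a1, _, a3⟩, b1, _, b3⟩ := eligible_flow_bounds hσ hf e
    rcases lt_or_ge 0 (N.reducedWeight σ.p e) with hw | hw
    · rw [netFlow, b3 hw, sub_zero]
      exact mul_nonneg hw.le a1
    · rw [netFlow, a3 (hw.trans_lt hδ), zero_sub]
      exact mul_nonneg_of_nonpos_of_nonpos hw (neg_nonpos.2 b1)
  rw [h2, h]
  linarith

/-! ### Invariants of the iterations -/

/-- Properties of flow and potentials that hold throughout the steps of size `δ`; `γ` is the grid
width. -/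
structure Valid (N : Network V E) (γ δ : ℝ) (σ : State V E) : Prop where
  feasible : N.Feasible σ.x
  p_s : σ.p N.s = 0
  grid : ∀ u, ∃ z : ℤ, σ.p u = z * γ
  residual : ∀ e, N.Accessible (N.tail e) → σ.x e < N.cap e → N.reducedWeight σ.p e < 2 * δ

theorem Valid.iteration {γ δ : ℝ} (hδ : 0 < δ) (hγ : ∃ m : ℤ, δ = m * γ) {σ σ' : State V E}
    (hσ : N.Valid γ δ σ) (h : N.Iteration δ σ σ') : N.Valid γ δ σ' := by
  obtain ⟨f, ⟨hf, _⟩, rfl⟩ := h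
  refine ⟨feasible_augment hσ.feasible hf, ?_, fun u => ?_, fun e he hx => ?_⟩
  · simp only [dualAdjust, if_pos (eligibleVertex_s _ _)]
    exact hσ.p_s
  · obtain ⟨z, hz⟩ := hσ.grid u
    obtain ⟨m, hm⟩ := hγ
    have hp : (augment σ f).p = σ.p := rfl
    rcases dualAdjust_p_eq δ (augment σ f) u with h | h <;> rw [h, hp, hz]
    · exact ⟨z, rfl⟩
    · exact ⟨z - m, by push_cast; linear_combination -hm⟩
  · refine reducedWeight_dualAdjust_lt hδ hx ?_
    obtain ⟨⟨a1, _, _⟩, b1, _, b3⟩ := eligible_flow_bounds hσ.feasible hf e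
    change N.reducedWeight σ.p e < 2 * δ
    -- An edge of positive reduced weight loses no flow, so it was already unsaturated.
    rcases le_or_gt (N.reducedWeight σ.p e) 0 with hw | hw
    · linarith
    · refine hσ.residual e he ?_
      have hx' : σ.x e + f (Sum.inl e) - f (Sum.inr e) < N.cap e := hx
      rw [b3 hw] at hx'
      linarith

/-- Violation of complementary slackness by flow-carrying edges, where a violation of `β` per level
is always accounted for. -/
noncomputable def slack (N : Network V E) (β : ℝ) (σ : State V E) : ℝ :=
  ∑ e, σ.x e * max (-N.reducedWeight σ.p e) (β * N.levelGap e)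

/-- The total number of levels climbed by a flow. -/
noncomputable def climb (N : Network V E) (x : E → ℝ) : ℝ := ∑ e, x e * N.levelGap e

theorem climb_nonneg {x : E → ℝ} (hx : N.Feasible x) : 0 ≤ N.climb x :=
  Finset.sum_nonneg fun e _ => mul_nonneg (hx.nonneg e) (N.levelGap_nonneg e)

/-- Edges gaining flow have positive reduced weight and pay exactly `β * levelGap`; edges losing
flow release at least that much. The level gaps telescope to `depth` per unit of value. -/
theorem slack_augment_le {δ β : ℝ} (hδ : 0 < δ) (hβ : 0 ≤ β) {σ : State V E} {f : E ⊕ E → ℝ}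
    (hσ : N.Feasible σ.x)
    (hf : IsFlow N.arcTail N.arcHead (N.eligibleCap δ σ) N.s N.t f) :
    N.slack β (augment σ f)
      ≤ N.slack β σ + β * (N.depth * netOut N.arcTail N.arcHead f N.s) := by
  rw [slack, sum_augment, ← sum_netFlow_levelGap hf, Finset.mul_sum]
  refine add_le_add le_rfl (Finset.sum_le_sum fun e _ => ?_)
  obtain ⟨⟨a1, _, a3⟩, b1, _, b3⟩ := eligible_flow_bounds hσ hf e
  have hL := mul_nonneg hβ (N.levelGap_nonneg e)
  change netFlow f e * max (-N.reducedWeight σ.p e) (β * N.levelGap e) ≤ _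
  rcases lt_or_ge 0 (N.reducedWeight σ.p e) with hw | hw
  · rw [max_eq_right (by linarith)]
    exact le_of_eq (by ring)
  · rw [netFlow, a3 (hw.trans_lt hδ)]
    have := mul_le_mul_of_nonneg_left
      (le_max_right (-N.reducedWeight σ.p e) (β * N.levelGap e)) b1
    linarith

/-- A reduced weight that drops was positive and ends above `-δ`. Flow edges climb at least one
level, so `δ ≤ β` absorbs this; if positive values are at least `δ`, the result stays nonnegative.
-/
theorem slack_dualAdjust_le {δ β : ℝ} (hδ : 0 < δ) (hβ : 0 ≤ β) {σ : State V E}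
    (hσ : N.Feasible σ.x)
    (h : δ ≤ β ∨ ∀ e, 0 < N.reducedWeight σ.p e → δ ≤ N.reducedWeight σ.p e) :
    N.slack β (N.dualAdjust δ σ) ≤ N.slack β σ := by
  refine Finset.sum_le_sum fun e _ => ?_
  change σ.x e * _ ≤ _
  rcases (hσ.nonneg e).eq_or_lt with h0 | h0
  · rw [← h0, zero_mul, zero_mul]
  refine mul_le_mul_of_nonneg_left (max_le ?_ (le_max_right _ _)) h0.le
  rcases reducedWeight_dualAdjust_ge hδ h0 with hw | ⟨hpos, hw⟩
  · exact (neg_le_neg hw).trans (le_max_left _ _)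
  · refine le_trans ?_ (le_max_right _ _)
    rcases h with h | h
    · have hacc : N.Accessible (N.tail e) := by
        by_contra hc
        exact h0.ne' (hσ.eq_zero hc)
      have := mul_le_mul_of_nonneg_left (N.one_le_levelGap hacc) hβ
      linarith
    · have := h e hpos
      have := mul_nonneg hβ (N.levelGap_nonneg e)
      linarith

theorem slack_mono {β β' : ℝ} (h : β ≤ β') {σ : State V E} (hσ : N.Feasible σ.x) :
    N.slack β σ ≤ N.slack β' σ :=
  Finset.sum_le_sum fun e _ => mul_le_mul_of_nonneg_left
    (max_le_max le_rfl (mul_le_mul_of_nonneg_right h (N.levelGap_nonneg e))) (hσ.nonneg e)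

theorem slack_rescale_le {δ : ℝ} (hδ : 0 < δ) {σ : State V E} (hσ : N.Feasible σ.x) :
    N.slack δ (N.rescale δ σ) ≤ N.slack δ σ + δ * N.climb σ.x := by
  rw [slack, slack, climb, Finset.mul_sum, ← Finset.sum_add_distrib]
  refine Finset.sum_le_sum fun e _ => ?_
  rw [reducedWeight_rescale]
  change σ.x e * _ ≤ _
  have hL := mul_nonneg hδ.le (N.levelGap_nonneg e)
  have h : max (-(N.reducedWeight σ.p e - δ * N.levelGap e)) (δ * N.levelGap e)
      ≤ max (-N.reducedWeight σ.p e) (δ * N.levelGap e) + δ * N.levelGap e := by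
    refine max_le ?_ ?_
    · linarith [le_max_left (-N.reducedWeight σ.p e) (δ * N.levelGap e)]
    · linarith [le_max_right (-N.reducedWeight σ.p e) (δ * N.levelGap e)]
  calc _ ≤ _ := mul_le_mul_of_nonneg_left h (hσ.nonneg e)
    _ = _ := by ring

/-- The slack, with a reserve for later rescalings, stays within an `η` fraction of the weight. -/
theorem slack_le_weight_iteration {γ δ η target : ℝ} (hδ : 0 < δ) (hη : 0 ≤ η)
    (htarget : 3 * δ * N.depth ≤ η * target) {σ σ' : State V E} (ht : target ≤ σ.p N.t)
    (hσ : N.Valid γ δ σ) (h : N.Iteration δ σ σ')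
    (hle : N.slack δ σ + 2 * δ * N.climb σ.x ≤ η * N.weight σ.x) :
    N.slack δ σ' + 2 * δ * N.climb σ'.x ≤ η * N.weight σ'.x := by
  obtain ⟨f, ⟨hf, _⟩, rfl⟩ := h
  have h1 := slack_dualAdjust_le hδ hδ.le (feasible_augment hσ.feasible hf) (.inl le_rfl)
  have h2 := slack_augment_le hδ hδ.le hσ.feasible hf
  have h3 : N.climb (augment σ f).x
      = N.climb σ.x + N.depth * netOut N.arcTail N.arcHead f N.s := by
    rw [climb, sum_augment, sum_netFlow_levelGap hf]
    rfl
  have h4 := mul_value_le_sum_netFlow hδ hσ.feasible hσ.p_s hf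
  have h5 := weight_augment (N := N) σ f
  have h6 := mul_le_mul_of_nonneg_right ht hf.value_nonneg
  have h7 := mul_le_mul_of_nonneg_left (h6.trans h4) hη
  have h8 := mul_le_mul_of_nonneg_right htarget hf.value_nonneg
  change N.slack δ (N.dualAdjust δ (augment σ f)) + 2 * δ * N.climb (augment σ f).x
    ≤ η * N.weight (augment σ f).x
  rw [h3, h5]
  linarith

/-- With step size equal to the grid width, no new slack appears. -/
theorem slack_zero_le_weight_iteration {γ η : ℝ} (hγ : 0 < γ) (hη : 0 ≤ η)
    (hgrid : ∀ e, ∃ z : ℤ, N.w e = z * γ) {σ σ' : State V E} (ht : 0 ≤ σ.p N.t)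
    (hσ : N.Valid γ γ σ) (h : N.Iteration γ σ σ')
    (hle : N.slack 0 σ ≤ η * N.weight σ.x) :
    N.slack 0 σ' ≤ η * N.weight σ'.x := by
  obtain ⟨f, ⟨hf, _⟩, rfl⟩ := h
  have hint (e : E) (he : 0 < N.reducedWeight σ.p e) : γ ≤ N.reducedWeight σ.p e := by
    obtain ⟨a, ha⟩ := hgrid e
    obtain ⟨b, hb⟩ := hσ.grid (N.tail e)
    obtain ⟨c, hc⟩ := hσ.grid (N.head e)
    have hz : N.reducedWeight σ.p e = ((a + b - c : ℤ) : ℝ) * γ := by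
      rw [reducedWeight, ha, hb, hc]; push_cast; ring
    rw [hz] at he ⊢
    have h1 : (0 : ℝ) < ((a + b - c : ℤ) : ℝ) := pos_of_mul_pos_left he hγ.le
    have h2 : (1 : ℝ) ≤ ((a + b - c : ℤ) : ℝ) := by
      exact_mod_cast Int.add_one_le_iff.2 (Int.cast_pos.1 h1)
    exact le_mul_of_one_le_left hγ.le h2
  have h1 := slack_dualAdjust_le hγ le_rfl (feasible_augment hσ.feasible hf) (.inr hint)
  have h2 := slack_augment_le hγ le_rfl hσ.feasible hf
  have h4 := mul_value_le_sum_netFlow hγ hσ.feasible hσ.p_s hf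
  have h5 := weight_augment (N := N) σ f
  have h7 := mul_le_mul_of_nonneg_left ((mul_nonneg ht hf.value_nonneg).trans h4) hη
  change N.slack 0 (N.dualAdjust γ (augment σ f)) ≤ η * N.weight (augment σ f).x
  rw [h5]
  linarith

theorem Valid.rescale {γ δ : ℝ} (hδ : 0 < δ) (hγ : ∃ m : ℤ, δ = m * γ) {σ : State V E}
    (hσ : N.Valid γ δ σ) : N.Valid γ (δ / 2) (N.rescale δ σ) := by
  refine ⟨hσ.feasible, ?_, fun u => ?_, fun e he hx => ?_⟩
  · simp [Network.rescale, N.level_s, hσ.p_s]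
  · obtain ⟨z, hz⟩ := hσ.grid u
    obtain ⟨m, hm⟩ := hγ
    refine ⟨z + m * N.level u, ?_⟩
    simp only [Network.rescale, hz]
    push_cast
    linear_combination (N.level u : ℝ) * hm
  · rw [reducedWeight_rescale]
    have h1 := hσ.residual e he hx
    have h2 := mul_le_mul_of_nonneg_left (N.one_le_levelGap he) hδ.le
    linarith

theorem stepSize_succ (ε wmax : ℝ) (i : ℕ) :
    stepSize ε wmax (i + 1) = stepSize ε wmax i / 2 := by
  rw [stepSize, stepSize, pow_succ, div_div]

theorem stepSize_pos {ε wmax : ℝ} (hε : 0 < ε) (hw : 0 < wmax) (i : ℕ) :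
    0 < stepSize ε wmax i := by
  unfold stepSize; positivity

theorem stepSize_eq_mul (ε wmax : ℝ) {i T : ℕ} (h : i ≤ T) :
    ∃ m : ℤ, stepSize ε wmax i = m * stepSize ε wmax T := by
  obtain ⟨d, rfl⟩ := Nat.exists_eq_add_of_le h
  refine ⟨2 ^ d, ?_⟩
  rw [stepSize, stepSize, pow_add]
  push_cast
  field_simp

theorem Scales.result {ε wmax : ℝ} {T i : ℕ} (hε : 0 < ε) (hw : 0 < wmax)
    (hgrid : ∀ e, ∃ z : ℤ, N.w e = z * stepSize ε wmax T) {σ σ' : State V E}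
    (h : N.Scales ε wmax T i σ σ') (hσ : N.Valid (stepSize ε wmax T) (stepSize ε wmax i) σ)
    (hle : N.slack (stepSize ε wmax i) σ + 2 * stepSize ε wmax i * N.climb σ.x
      ≤ 6 * ε * N.weight σ.x) :
    N.Valid (stepSize ε wmax T) (stepSize ε wmax T) σ' ∧ σ'.p N.t = 0 ∧
      N.slack 0 σ' ≤ 6 * ε * N.weight σ'.x := by
  induction h with
  | last σ σ' hl =>
    have hpos := stepSize_pos hε hw T
    have ht0 : N.scaleTarget wmax T T = 0 := by simp [scaleTarget]
    rw [ht0] at hl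
    have h0 : N.slack 0 σ ≤ 6 * ε * N.weight σ.x := by
      have h1 := slack_mono hpos.le hσ.feasible
      have h2 := mul_nonneg hpos.le (climb_nonneg hσ.feasible)
      linarith
    have key := hl.invariant hpos
      (I := fun τ => N.Valid (stepSize ε wmax T) (stepSize ε wmax T) τ ∧
        N.slack 0 τ ≤ 6 * ε * N.weight τ.x)
      (fun τ τ' ht hi hI => ⟨hI.1.iteration hpos ⟨1, by simp⟩ hi,
        slack_zero_le_weight_iteration hpos (by positivity) hgrid ht hI.1 hi hI.2⟩) ⟨hσ, h0⟩
    exact ⟨key.1, hl.p_t_eq, key.2⟩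
  | next i σ σ' σ'' hi hl _ ih =>
    have hpos := stepSize_pos hε hw i
    have hm := stepSize_eq_mul ε wmax hi.le
    -- The constant `6` comes from here: `target` is `depth * wmax / 2 ^ (i + 1)`, and equality
    -- holds.
    have htarget : 3 * stepSize ε wmax i * N.depth ≤ 6 * ε * N.scaleTarget wmax T i := by
      rw [scaleTarget, if_pos hi, stepSize, pow_succ]
      exact le_of_eq (by field_simp; ring)
    have key := hl.invariant hpos
      (I := fun τ => N.Valid (stepSize ε wmax T) (stepSize ε wmax i) τ ∧
        N.slack (stepSize ε wmax i) τ + 2 * stepSize ε wmax i * N.climb τ.x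
          ≤ 6 * ε * N.weight τ.x)
      (fun τ τ' ht hi hI => ⟨hI.1.iteration hpos hm hi,
        slack_le_weight_iteration hpos (by positivity) htarget ht hI.1 hi hI.2⟩) ⟨hσ, hle⟩
    have hv := key.1.rescale hpos hm
    refine ih (by rwa [stepSize_succ]) ?_
    rw [stepSize_succ]
    -- Of the reserve `2 * δ * climb`, one half pays for rescaling and the other is the reserve at
    -- step size `δ / 2`.
    have h1 := slack_mono (half_le_self hpos.le) hv.feasible
    have h2 := slack_rescale_le hpos key.1.feasible
    have h3 := key.2
    change _ + 2 * (stepSize ε wmax i / 2) * N.climb σ'.x ≤ 6 * ε * N.weight σ'.x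
    linarith

theorem valid_initial {γ δ wmax : ℝ} (hδ : 0 < δ) (hγ : ∃ m : ℤ, wmax = m * γ)
    (hw : ∀ e, N.w e ≤ wmax) (hwmax : 0 ≤ wmax) : N.Valid γ δ (N.initial wmax) := by
  refine ⟨⟨fun _ => le_rfl, N.cap_nonneg, fun u _ _ => by simp [netOut, initial],
    by simp [netOut, initial]⟩, by simp [initial, N.level_s], fun u => ?_, fun e he _ => ?_⟩
  · obtain ⟨m, hm⟩ := hγ
    exact ⟨m * N.level u, by simp only [initial]; push_cast; linear_combination N.level u * hm⟩
  · have h1 := mul_le_mul_of_nonneg_left (N.one_le_levelGap he) hwmax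
    have h2 : N.reducedWeight (N.initial wmax).p e = N.w e - wmax * N.levelGap e := by
      simp only [reducedWeight, initial, levelGap]; ring
    rw [h2]
    linarith [hw e]

/-- Approximate complementary slackness bounds the loss against any other flow. -/
theorem Valid.weight_le {γ δ : ℝ} (hδ : 0 ≤ δ) {σ : State V E} (hσ : N.Valid γ δ σ) (ht : σ.p N.t = 0)
    {y : E → ℝ} (hy : N.Feasible y) :
    N.weight y ≤ N.weight σ.x + ∑ e, 2 * δ * y e + N.slack 0 σ := by
  have h1 := hσ.feasible.sum_reducedWeight hσ.p_s
  have h2 := hy.sum_reducedWeight hσ.p_s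
  rw [ht, zero_mul, sub_zero] at h1 h2
  rw [weight, weight, ← h1, ← h2, slack, ← Finset.sum_add_distrib, ← Finset.sum_add_distrib]
  refine Finset.sum_le_sum fun e _ => ?_
  by_cases he : N.Accessible (N.tail e)
  · have hx0 := hσ.feasible.nonneg e
    have hy0 := hy.nonneg e
    rw [zero_mul]
    set r := N.reducedWeight σ.p e
    have hm1 : -r ≤ max (-r) 0 := le_max_left _ _
    have hm2 : 0 ≤ max (-r) 0 := le_max_right _ _
    -- If `y` uses less of the edge, the slack term pays; if more, the edge is unsaturated and `2 *
    -- δ` bounds the gain.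
    rcases le_or_gt (y e) (σ.x e) with hyx | hyx
    · have h3 : -r * (σ.x e - y e) ≤ max (-r) 0 * (σ.x e - y e) :=
        mul_le_mul_of_nonneg_right hm1 (sub_nonneg.2 hyx)
      have h4 := mul_nonneg hm2 hy0
      have h5 := mul_nonneg hδ hy0
      linarith
    · have h3 := hσ.residual e he (hyx.trans_le (hy.le_cap e))
      have h4 : r * (y e - σ.x e) ≤ 2 * δ * (y e - σ.x e) :=
        mul_le_mul_of_nonneg_right h3.le (sub_nonneg.2 hyx.le)
      have h5 := mul_nonneg hm2 hx0
      have h6 := mul_nonneg hδ hx0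
      linarith
  · simp [hy.eq_zero he, hσ.feasible.eq_zero he]

end Finite

end Network

end ScalingFlow

open ScalingFlow ScalingFlow.Network in
theorem mainTheorem4 {V E : Type*} [Fintype V] [Fintype E] (N : ScalingFlow.Network V E)
    (ε wmin wmax : ℝ) (T i₀ : ℕ)
    (hwmin : 0 < wmin)
    -- `ε` and `wmax / wmin` are powers of two, `T = log₂ (wmax / wmin)`
    (hε : ∃ k : ℕ, ε = 1 / 2 ^ k)
    (hT : wmax / wmin = 2 ^ T)
    -- the first scale is `0` or `1`, and there is at least one scale
    (hi₀ : i₀ ≤ 1) (hi₀T : i₀ ≤ T)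
    (hw : ∀ e, wmin ≤ |N.w e| ∧ |N.w e| ≤ wmax)
    -- all weights are integer multiples of the final step size
    (hgrid : ∀ e, ∃ z : ℤ, N.w e = z * (ε * wmin))
    (x xstar : E → ℝ)
    (hx : N.Returns ε wmax i₀ T x) (hxstar : N.Optimal xstar) :
    (1 - 8 * ε) * ∑ e with 0 < N.w e, N.w e * xstar e
        + (1 + 8 * ε) * ∑ e with N.w e < 0, N.w e * xstar e
      ≤ ∑ e, N.w e * x e := by
  obtain ⟨σ, hσ, rfl⟩ := hx
  obtain ⟨k, hk⟩ := hε
  have hε0 : 0 < ε := by rw [hk]; positivity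
  have hwmax : wmax = 2 ^ T * wmin := (div_eq_iff hwmin.ne').1 hT
  have hwmax0 : 0 < wmax := by rw [hwmax]; positivity
  have hδ : stepSize ε wmax T = ε * wmin := by
    rw [stepSize, hwmax]; field_simp
  -- This puts the initial potentials on the grid.
  have hmult : ∃ m : ℤ, wmax = m * stepSize ε wmax T :=
    ⟨2 ^ T * 2 ^ k, by rw [hδ, hwmax, hk]; push_cast; field_simp⟩
  have hzero : N.slack (stepSize ε wmax i₀) (N.initial wmax)
      + 2 * stepSize ε wmax i₀ * N.climb (N.initial wmax).x
        ≤ 6 * ε * N.weight (N.initial wmax).x := by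
    simp [slack, climb, weight, initial]
  obtain ⟨hv, ht, hs⟩ := hσ.result hε0 hwmax0 (by simpa only [hδ] using hgrid)
    (valid_initial (stepSize_pos hε0 hwmax0 i₀) hmult
      (fun e => (le_abs_self _).trans (hw e).2) hwmax0.le) hzero
  have h1 := hv.weight_le (stepSize_pos hε0 hwmax0 T).le ht hxstar.1
  have h2 : N.weight σ.x ≤ N.weight xstar := hxstar.2 σ.x hv.feasible
  set P := ∑ e with 0 < N.w e, N.w e * xstar e with hP
  set M := ∑ e with N.w e < 0, N.w e * xstar e with hM
  have hsplit : N.weight xstar = P + M := by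
    rw [hP, hM, Finset.sum_filter, Finset.sum_filter, ← Finset.sum_add_distrib, weight]
    refine Finset.sum_congr rfl fun e _ => ?_
    rcases lt_trichotomy (N.w e) 0 with h | h | h
    · simp [h, h.not_gt]
    · simp [h]
    · simp [h, h.not_gt]
  have habs : ∑ e, 2 * stepSize ε wmax T * xstar e ≤ 2 * ε * (P - M) := by
    rw [hP, hM, Finset.sum_filter, Finset.sum_filter, ← Finset.sum_sub_distrib, Finset.mul_sum, hδ]
    refine Finset.sum_le_sum fun e _ => ?_
    have h3 := mul_le_mul_of_nonneg_right (hw e).1 (hxstar.1.nonneg e)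
    have h4 : (if 0 < N.w e then N.w e * xstar e else 0)
        - (if N.w e < 0 then N.w e * xstar e else 0) = |N.w e| * xstar e := by
      rcases lt_trichotomy (N.w e) 0 with h | h | h
      · simp [h, h.not_gt, abs_of_neg h]
      · simp [h]
      · simp [h, h.not_gt, abs_of_pos h]
    rw [h4]
    have := mul_le_mul_of_nonneg_left h3 hε0.le
    linarith
  -- The total loss `2 * ε * (P - M) + 6 * ε * (P + M)` is at most `8 * ε * (P - M)` because `M ≤
  -- 0`.
  have hMle : M ≤ 0 := Finset.sum_nonpos fun e he =>
    mul_nonpos_of_nonpos_of_nonneg (Finset.mem_filter.1 he).2.le (hxstar.1.nonneg e)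
  have h5 := mul_le_mul_of_nonneg_left h2 hε0.le
  have h6 := mul_nonpos_of_nonneg_of_nonpos hε0.le hMle
  change _ ≤ N.weight σ.x
  rw [hsplit] at h1 h5
  linarith
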